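/- A weighted graph $G=(V,w)$ is a vertex set $V$ with a symmetric function $w:V\times V\to[0,\infty)$ such that $w_x:=\sum_{y} w(x,y)<\infty$ for every vertex $x$; its edges are the unordered pairs $\{x,y\}$ (loops $x=y$ allowed) with $w(x,y)>0$. Let $G$ be an infinite weighted graph and let $o$ be a vertex with $w_o>0$. Write $|v|$ for the graph distance from $o$ to $v$. For $n\ge 0$ let $w_n$ be the total weight of the edges at distance $n$ from $o$, where the distance from $o$ to an edge $\{x,y\}$ is $\min(|x|,|y|)$. Let $g_0=\limsup_{n\to\infty} w_n^{1/n}\in[0,\infty]$ be the exponential upper growth of $G$, and let $g=\max(g_0,1)$. Let $(X_k)_{k\ge0}$ be the random walk on $G$ started at $o$, that is, the Markov chain with $X_0=o$ almost surely and transition probabilities $p(x,y)=w(x,y)/w_x$. Then $$\limsup_{k\to\infty}\frac{|X_k|}{k}\le\frac{g-1}{g+1}\quad\text{almost surely},$$ where the right-hand side is read as its limit $1$ if $g=\infty$. -/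

import Mathlib

open MeasureTheory Filter
open scoped NNReal ENNReal

/-- A weighted graph on the vertex set `V`: a symmetric nonnegative weight function whose support is
the edge set (loops are allowed).  The total weight of the edges incident to a vertex is finite, so
that the random walk makes sense; vertices may have infinitely many neighbours. -/
structure WeightedGraph (V : Type*) where
  /-- the edge weights -/
  w : V → V → ℝ≥0
  symm : ∀ x y, w x y = w y x
  finite_weight : ∀ x, ∑' y, (w x y : ℝ≥0∞) ≠ ⊤

namespace WeightedGraph

variable {V : Type*} (G : WeightedGraph V)

/-- The weight `w_x` of a vertex: the sum of the weights of the edges incident to it. -/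
noncomputable def vertexWeight (x : V) : ℝ≥0∞ := ∑' y, (G.w x y : ℝ≥0∞)

/-- The underlying simple graph: the support of `w`, without the loops (which do not affect
distances). -/
def toSimpleGraph : SimpleGraph V where
  Adj x y := x ≠ y ∧ G.w x y ≠ 0
  symm := ⟨fun x y h => ⟨h.1.symm, by rw [G.symm y x]; exact h.2⟩⟩
  loopless := ⟨fun _ h => h.1 rfl⟩

/-- The graph distance between two vertices (infinite if there is no path between them). -/
noncomputable def distance (x y : V) : ℕ∞ := G.toSimpleGraph.edist x y

/-- The weight of an unordered pair of vertices (zero if the pair is not an edge). -/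
def edgeWeight : Sym2 V → ℝ≥0∞ :=
  Sym2.lift ⟨fun x y => (G.w x y : ℝ≥0∞), fun x y => congrArg _ (G.symm x y)⟩

/-- The distance from `o` to an edge: the distance from `o` to its nearer endpoint. -/
noncomputable def edgeDistance (o : V) : Sym2 V → ℕ∞ :=
  Sym2.lift ⟨fun x y => min (G.distance o x) (G.distance o y), fun _ _ => min_comm _ _⟩

/-- The total weight `w_n` of the edges at distance `n` from `o`. -/
noncomputable def levelWeight (o : V) (n : ℕ) : ℝ≥0∞ :=
  ∑' e : {e : Sym2 V // G.edgeDistance o e = (n : ℕ∞)}, G.edgeWeight e.1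

/-- The exponential upper growth `limsup w_n ^ (1 / n)`, an element of `[0, ∞]`. -/
noncomputable def upperGrowth (o : V) : ℝ≥0∞ :=
  limsup (fun n : ℕ => G.levelWeight o n ^ (1 / (n : ℝ))) atTop

/-- The probability that the walk at `x` moves to `y` in one step. -/
noncomputable def transitionProb (x y : V) : ℝ≥0∞ := (G.w x y : ℝ≥0∞) / G.vertexWeight x

/-- The process `X` on the probability space `(Ω, P)` is the random walk on `G` started at `o`:
a Markov chain with transition probabilities `w x y / w_x` that starts at `o`. -/
structure IsRandomWalk {Ω : Type*} [MeasurableSpace Ω] (P : Measure Ω) (o : V)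
    (X : ℕ → Ω → V) : Prop where
  measurableSet_eq : ∀ k x, MeasurableSet {ω | X k ω = x}
  start : P {ω | X 0 ω = o} = 1
  step : ∀ (n : ℕ) (x : ℕ → V) (y : V),
    P {ω | (∀ i ≤ n, X i ω = x i) ∧ X (n + 1) ω = y}
      = P {ω | ∀ i ≤ n, X i ω = x i} * G.transitionProb (x n) y

end WeightedGraph

/-- The quantity `(g - 1) / (g + 1)` for `1 ≤ g ≤ ∞`, equal to its limit `1` at `g = ∞`. -/
noncomputable def speedBound (g : ℝ≥0∞) : ℝ≥0∞ := if g = ⊤ then 1 else (g - 1) / (g + 1)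

/-! The probability of being beyond level `m` at time `k` is at most `exp (θ k) * E[s ^ T]`, where
`s = exp (-θ)` and `T` is the time of the first passage beyond level `m` (with `s ^ T = 0` if there
is none). So the task is to bound `h o = E[s ^ T]` from above, and an entropy balance does it.

Weight trajectories by `s ^ T`. With the Green density `v` from `o`, the expected number of
crossings from `x` to `y` is the flow `f x y = s * w x y * v x * h y`, and by symmetry of `w` the
log-ratio of `f x y` and `f y x` is `φ x - φ y` for `φ = log (v / h)`. Hence the entropy production,
the sum of `f x y * (φ x - φ y)`, is a boundary term. It is at most `h o * (log S - 2 log (h o) +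
const)`, where `S` is the total exit weight, at most `w_m` (`flow_log_le`). From below, a
tangent-line inequality for `(f - b) * log (f / b)` bounds it by `γ + sinh γ` times the net
displacement `m * h o`, minus `cosh γ - 1` times the number of steps (`pair_bound`, `flow_log_ge`).
By Jensen, the number of steps is at most `h o * (-log (h o)) / θ` (`expected_time_le`).

If `w_m ≤ exp (γ m)`, the terms in `γ m` cancel and `sinh γ * m ≤ const + (2 + (cosh γ - 1) / θ) *
(-log (h o))` remains (`log_bound`). For `m ≈ a k` and small `θ` this beats `exp (θ k)` as soon as
`a * sinh γ > cosh γ - 1`, that is, `a > tanh (γ / 2) = (q - 1) / (q + 1)` with `q = exp γ`.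
Borel–Cantelli concludes.

Vertices may have infinitely many neighbours, so the network argument runs on finite sets of
vertices that exhaust a countable ball. -/

/-- Both sides agree to first order at `t = γ`. With `u = t - γ` the difference is `exp γ * (exp u *
(u - 1) + 1) + (exp u - 1 - u)`, a sum of two nonnegative terms. -/
theorem entropy_pair_bound (γ t : ℝ) :
    γ * (Real.exp t - 1) + (1 - Real.exp (-γ)) * Real.exp t - (Real.exp γ - 1)
      ≤ (Real.exp t - 1) * t := by
  obtain ⟨u, rfl⟩ : ∃ u, t = u + γ := ⟨t - γ, by ring⟩
  have h1 : 0 ≤ Real.exp u * (u - 1) + 1 := by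
    have h := Real.add_one_le_exp (-u)
    have h2 : Real.exp u * Real.exp (-u) = 1 := by rw [← Real.exp_add]; simp
    nlinarith [Real.exp_pos u]
  have h2 := Real.add_one_le_exp u
  have h3 : Real.exp (-γ) * Real.exp γ = 1 := by rw [← Real.exp_add]; simp
  have h4 : Real.exp (-γ) * (Real.exp u * Real.exp γ) = Real.exp u := by
    rw [mul_left_comm, h3, mul_one]
  have h5 := mul_nonneg (Real.exp_pos γ).le h1
  rw [Real.exp_add]
  nlinarith

/-! ### Finite killed networks: minimum principle and resolvent -/

/-- A finite network with killing: symmetric weights `w`, weights `c` of the exits, and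
vertex masses `W` which dominate the total weight at each vertex. -/
structure KilledNetwork (ι : Type*) [Fintype ι] where
  w : ι → ι → ℝ
  c : ι → ℝ
  W : ι → ℝ
  symm : ∀ x y, w x y = w y x
  w_nonneg : ∀ x y, 0 ≤ w x y
  c_nonneg : ∀ x, 0 ≤ c x
  W_pos : ∀ x, 0 < W x
  sum_le : ∀ x, ∑ y, w x y + c x ≤ W x

namespace KilledNetwork

variable {ι : Type*} [Fintype ι] (N : KilledNetwork ι)

theorem sum_w_le (x : ι) : ∑ y, N.w x y ≤ N.W x := by
  linarith [N.sum_le x, N.c_nonneg x]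

/-- Minimum principle: at a negative minimum, averaging and killing cannot decrease `u`, and the
factor `s < 1` strictly increases it. -/
theorem nonneg_of_supersolution {s : ℝ} (hs0 : 0 ≤ s) (hs1 : s < 1) (u : ι → ℝ)
    (hu : ∀ x, s * ∑ y, N.w x y * u y ≤ N.W x * u x) (x : ι) : 0 ≤ u x := by
  obtain ⟨z, -, hz⟩ := Finset.exists_min_image Finset.univ u ⟨x, Finset.mem_univ x⟩
  refine le_trans ?_ (hz x (Finset.mem_univ x))
  by_contra! hneg
  have h1 : (∑ y, N.w z y) * u z ≤ ∑ y, N.w z y * u y := by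
    rw [Finset.sum_mul]
    exact Finset.sum_le_sum fun y _ =>
      mul_le_mul_of_nonneg_left (hz y (Finset.mem_univ y)) (N.w_nonneg z y)
  have h2 : N.W z * u z ≤ (∑ y, N.w z y) * u z :=
    mul_le_mul_of_nonpos_right (N.sum_w_le z) hneg.le
  have h3 : s * (N.W z * u z) ≤ N.W z * u z :=
    (mul_le_mul_of_nonneg_left (h2.trans h1) hs0).trans (hu z)
  have h4 : N.W z * u z < 0 := mul_neg_of_pos_of_neg (N.W_pos z) hneg
  nlinarith

theorem exists_resolvent [DecidableEq ι] {s : ℝ} (hs0 : 0 ≤ s) (hs1 : s < 1) (r : ι → ℝ) :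
    ∃ u : ι → ℝ, ∀ x, N.W x * u x = r x + s * ∑ y, N.w x y * u y := by
  let A : (ι → ℝ) →ₗ[ℝ] (ι → ℝ) :=
    { toFun := fun u x => N.W x * u x - s * ∑ y, N.w x y * u y
      map_add' := fun u v => by
        ext x
        simp only [Pi.add_apply, mul_add, Finset.sum_add_distrib]
        ring
      map_smul' := fun a u => by
        ext x
        simp only [Pi.smul_apply, smul_eq_mul, RingHom.id_apply, mul_sub]
        congr 1
        · ring
        · rw [mul_left_comm, Finset.mul_sum _ _ a]
          congr 1
          exact Finset.sum_congr rfl fun y _ => by ring }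
  have hA : ∀ u x, A u x = N.W x * u x - s * ∑ y, N.w x y * u y := fun _ _ => rfl
  have hinj : Function.Injective A := by
    rw [← LinearMap.ker_eq_bot, LinearMap.ker_eq_bot']
    intro u hu
    have hu' : ∀ x, N.W x * u x - s * ∑ y, N.w x y * u y = 0 := fun x => by
      rw [← hA, hu]; rfl
    ext x
    apply le_antisymm
    · have := N.nonneg_of_supersolution hs0 hs1 (fun x => -u x) (fun x => by
        simp only [mul_neg, Finset.sum_neg_distrib]
        linarith [hu' x]) x
      simpa using this
    · exact N.nonneg_of_supersolution hs0 hs1 u (fun x => by linarith [hu' x]) x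
  obtain ⟨u, hu⟩ := (LinearMap.injective_iff_surjective.mp hinj) r
  exact ⟨u, fun x => by rw [← hu, hA]; ring⟩

/-! ### Exit function, Green density and the flow they define -/

/-- `h` is the discounted exit function: the expectation of `s ^ T`, with `T` the exit time. -/
def IsExit (s : ℝ) (h : ι → ℝ) : Prop :=
  ∀ x, N.W x * h x = s * (∑ y, N.w x y * h y + N.c x)

/-- `v` is the discounted Green density from `o`. -/
def IsGreen [DecidableEq ι] (s : ℝ) (o : ι) (v : ι → ℝ) : Prop :=
  ∀ x, N.W x * v x = (if x = o then 1 else 0) + s * ∑ y, N.w x y * v y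

variable {N} {s : ℝ} {h : ι → ℝ}

theorem IsExit.nonneg (hh : N.IsExit s h) (hs0 : 0 ≤ s) (hs1 : s < 1) (x : ι) : 0 ≤ h x :=
  N.nonneg_of_supersolution hs0 hs1 h (fun x => by
    rw [hh x, mul_add]
    linarith [mul_nonneg hs0 (N.c_nonneg x)]) x

theorem IsExit.le_one (hh : N.IsExit s h) (hs0 : 0 ≤ s) (hs1 : s < 1) (x : ι) : h x ≤ 1 := by
  have := N.nonneg_of_supersolution hs0 hs1 (fun x => 1 - h x) (fun x => by
    simp only [mul_sub, mul_one, Finset.sum_sub_distrib]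
    have := hh x
    have h1 := mul_le_mul_of_nonneg_left (N.sum_le x) hs0
    have h2 : s * N.W x ≤ N.W x := by nlinarith [N.W_pos x]
    linarith) x
  linarith

/-- The entropy estimate: if `T` is the exit time, `E[s ^ T] = h o` and
`θ E[T s ^ T] ≤ - h o log (h o)` for `s = exp (-θ)`, by Jensen's inequality. -/
theorem IsExit.entropy_step {θ : ℝ} (hθ : 0 < θ) (hh : N.IsExit (Real.exp (-θ)) h) (x : ι) :
    Real.exp (-θ) * ∑ y, N.w x y * (h y).negMulLog + θ * (N.W x * h x)
      ≤ N.W x * (h x).negMulLog := by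
  have hs0 := (Real.exp_pos (-θ)).le
  have hs1 : Real.exp (-θ) < 1 := by simpa using hθ
  have h0 := hh.nonneg hs0 hs1
  have hW := N.W_pos x
  have hd : 0 ≤ N.W x - (∑ y, N.w x y + N.c x) := sub_nonneg.mpr (N.sum_le x)
  -- One step of the walk has three outcomes: it is killed (value `0`), it exits (value `1`), or it
  -- moves to `y` (value `h y`). The mean is `exp θ * h x`, and `negMulLog` vanishes at `0` and `1`,
  -- so only the moves contribute.
  have key := Real.concaveOn_negMulLog.le_map_sum
    (t := (Finset.univ : Finset (Option (Option ι))))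
    (w := fun i => match i with
      | none => (N.W x - (∑ y, N.w x y + N.c x)) / N.W x
      | some none => N.c x / N.W x
      | some (some y) => N.w x y / N.W x)
    (p := fun i => match i with
      | none => 0
      | some none => 1
      | some (some y) => h y)
    (by
      rintro (_ | _ | y) -
      · exact div_nonneg hd hW.le
      · exact div_nonneg (N.c_nonneg x) hW.le
      · exact div_nonneg (N.w_nonneg x y) hW.le)
    (by
      simp only [Fintype.sum_option]
      rw [← Finset.sum_div]
      field_simp
      ring)
    (by
      rintro (_ | _ | y) -
      · simp
      · simp
      · exact h0 y)
  simp only [Fintype.sum_option, smul_eq_mul, Real.negMulLog_zero, Real.negMulLog_one, mul_zero,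
    zero_add, mul_one] at key
  have e1 : ∑ y, N.w x y / N.W x * (h y).negMulLog
      = (∑ y, N.w x y * (h y).negMulLog) / N.W x := by
    rw [Finset.sum_div]; exact Finset.sum_congr rfl fun y _ => by ring
  have e2 : N.c x / N.W x + ∑ y, N.w x y / N.W x * h y = Real.exp θ * h x := by
    have e3 : ∑ y, N.w x y / N.W x * h y = (∑ y, N.w x y * h y) / N.W x := by
      rw [Finset.sum_div]; exact Finset.sum_congr rfl fun y _ => by ring
    rw [e3, ← add_div, div_eq_iff hW.ne', mul_assoc, mul_comm (h x), hh x, ← mul_assoc,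
      ← Real.exp_add]
    simp [add_comm]
  rw [e1, e2, Real.negMulLog_mul, div_le_iff₀ hW] at key
  have e4 : (Real.exp θ).negMulLog = - Real.exp θ * θ := by
    rw [Real.negMulLog, Real.log_exp]
  rw [e4] at key
  have e5 : Real.exp (-θ) * Real.exp θ = 1 := by rw [← Real.exp_add]; simp
  have key2 := mul_le_mul_of_nonneg_left key hs0
  have e6 : Real.exp (-θ) * ((h x * (-Real.exp θ * θ) + Real.exp θ * (h x).negMulLog) * N.W x)
      = N.W x * (h x).negMulLog - θ * (N.W x * h x) := by
    linear_combination (N.W x * (h x).negMulLog - θ * (N.W x * h x)) * e5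
  linarith

/-- When `v` is the Green density, the summand is the expected number of crossings from `x` to `y`
weighted by `s ^ T`. The exit step is not counted, so the total is `E[(T - 1) * s ^ T]`. -/
theorem flow_total (v : ι → ℝ) (hh : N.IsExit s h) :
    ∑ x, ∑ y, s * N.w x y * v x * h y = ∑ x, (N.W x * v x * h x - s * (v x * N.c x)) := by
  refine Finset.sum_congr rfl fun x _ => ?_
  have a1 : ∑ y, s * N.w x y * v x * h y = v x * (s * ∑ y, N.w x y * h y) := by
    rw [Finset.mul_sum, Finset.mul_sum]; exact Finset.sum_congr rfl fun y _ => by ring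
  rw [a1]
  linear_combination (-v x) * hh x

variable [DecidableEq ι] {o : ι} {v : ι → ℝ}

theorem IsGreen.nonneg (hv : N.IsGreen s o v) (hs0 : 0 ≤ s) (hs1 : s < 1) (x : ι) : 0 ≤ v x :=
  N.nonneg_of_supersolution hs0 hs1 v (fun x => by
    rw [hv x]
    split_ifs <;> linarith) x

/-- The constant on the right is a supersolution of the equation of `v`. -/
theorem IsGreen.le (hv : N.IsGreen s o v) (hs0 : 0 ≤ s) (hs1 : s < 1) (x : ι) :
    v x ≤ 1 / (N.W o * (1 - s)) := by
  set κ := 1 / (N.W o * (1 - s)) with hκ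
  have hpos : 0 < N.W o * (1 - s) := mul_pos (N.W_pos o) (by linarith)
  have hκ0 : 0 < κ := by positivity
  have := N.nonneg_of_supersolution hs0 hs1 (fun x => κ - v x) (fun x => by
    simp only [mul_sub, Finset.sum_sub_distrib]
    rw [hv x, ← Finset.sum_mul]
    have h1 : s * ((∑ y, N.w x y) * κ) ≤ s * (N.W x * κ) :=
      mul_le_mul_of_nonneg_left (mul_le_mul_of_nonneg_right (N.sum_w_le x) hκ0.le) hs0
    have h2 : (if x = o then (1 : ℝ) else 0) ≤ N.W x * κ * (1 - s) := by
      split_ifs with hx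
      · subst hx
        rw [hκ, mul_right_comm, mul_one_div, div_self hpos.ne']
      · exact mul_nonneg (mul_nonneg (N.W_pos x).le hκ0.le) (by linarith)
    linarith) x
  linarith

/-- Green's identity for the flow `s * w x y * v x * h y`. -/
theorem flow_identity (hh : N.IsExit s h) (hv : N.IsGreen s o v) (φ : ι → ℝ) :
    ∑ x, ∑ y, s * N.w x y * v x * h y * (φ x - φ y)
      = φ o * h o - s * ∑ x, φ x * (v x * N.c x) := by
  have e1 : ∑ x, ∑ y, s * N.w x y * v x * h y * φ y
      = ∑ x, ∑ y, s * N.w x y * v y * h x * φ x := by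
    rw [Finset.sum_comm]
    refine Finset.sum_congr rfl fun x _ => Finset.sum_congr rfl fun y _ => by rw [N.symm]
  simp only [mul_sub, Finset.sum_sub_distrib]
  rw [e1, Finset.mul_sum, ← Finset.sum_sub_distrib]
  have e2 : φ o * h o = ∑ x, if x = o then φ x * h x else 0 := by simp
  rw [e2, ← Finset.sum_sub_distrib]
  refine Finset.sum_congr rfl fun x _ => ?_
  have a1 : ∑ y, s * N.w x y * v x * h y * φ x = φ x * v x * (s * ∑ y, N.w x y * h y) := by
    rw [Finset.mul_sum, Finset.mul_sum]; exact Finset.sum_congr rfl fun y _ => by ring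
  have a2 : ∑ y, s * N.w x y * v y * h x * φ x = φ x * h x * (s * ∑ y, N.w x y * v y) := by
    rw [Finset.mul_sum, Finset.mul_sum]; exact Finset.sum_congr rfl fun y _ => by ring
  have b1 := hh x
  have b2 := hv x
  rw [a1, a2]
  split_ifs at b2 ⊢ <;> linear_combination φ x * h x * b2 - φ x * v x * b1

theorem IsExit.eq_sum_green (hh : N.IsExit s h) (hv : N.IsGreen s o v) :
    h o = s * ∑ x, v x * N.c x := by
  have := flow_identity hh hv (fun _ => 1)
  simp only [sub_self, mul_zero, Finset.sum_const_zero, one_mul] at this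
  linarith

theorem IsExit.sum_exit_pos (hh : N.IsExit s h) (hv : N.IsGreen s o v) (ho : 0 < h o) :
    0 < ∑ x, N.c x := by
  have hsum := hh.eq_sum_green hv
  refine lt_of_le_of_ne (Finset.sum_nonneg fun x _ => N.c_nonneg x) fun h0 => ?_
  have hc : ∀ x, N.c x = 0 := fun x =>
    (Finset.sum_eq_zero_iff_of_nonneg fun x _ => N.c_nonneg x).mp h0.symm x (Finset.mem_univ x)
  simp [hc] at hsum
  exact ho.ne' hsum

/-- The sum on the left is `E[T * s ^ T]`. Integrating `entropy_step` against `v`, the Green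
equation and the symmetry of `w` cancel everything but the entropy at `o`. -/
theorem IsExit.expected_time_le {θ : ℝ} (hθ : 0 < θ) (hh : N.IsExit (Real.exp (-θ)) h)
    (hv : N.IsGreen (Real.exp (-θ)) o v) :
    θ * ∑ x, N.W x * v x * h x ≤ (h o).negMulLog := by
  have hs0 := (Real.exp_pos (-θ)).le
  have hs1 : Real.exp (-θ) < 1 := by simpa using hθ
  have h1 : ∑ x, v x * (Real.exp (-θ) * ∑ y, N.w x y * (h y).negMulLog + θ * (N.W x * h x))
      ≤ ∑ x, v x * (N.W x * (h x).negMulLog) :=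
    Finset.sum_le_sum fun x _ => mul_le_mul_of_nonneg_left (hh.entropy_step hθ x)
      (hv.nonneg hs0 hs1 x)
  have h2 : ∑ x, v x * (N.W x * (h x).negMulLog) = (h o).negMulLog
      + ∑ x, Real.exp (-θ) * (∑ y, N.w x y * v y) * (h x).negMulLog := by
    have : (h o).negMulLog = ∑ x, if x = o then (h x).negMulLog else 0 := by simp
    rw [this, ← Finset.sum_add_distrib]
    refine Finset.sum_congr rfl fun x _ => ?_
    have := hv x
    split_ifs at this ⊢ <;> linear_combination (h x).negMulLog * this
  have h3 : ∑ x, v x * (Real.exp (-θ) * ∑ y, N.w x y * (h y).negMulLog)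
      = ∑ x, Real.exp (-θ) * (∑ y, N.w x y * v y) * (h x).negMulLog := by
    simp only [Finset.mul_sum, Finset.sum_mul]
    rw [Finset.sum_comm]
    refine Finset.sum_congr rfl fun x _ => Finset.sum_congr rfl fun y _ => ?_
    rw [N.symm]; ring
  have h4 : ∑ x, v x * (θ * (N.W x * h x)) = θ * ∑ x, N.W x * v x * h x := by
    rw [Finset.mul_sum]; exact Finset.sum_congr rfl fun y _ => by ring
  simp only [mul_add, Finset.sum_add_distrib] at h1
  linarith

/-- There is a Green density supported where the exit function is positive. -/
theorem exists_green (hs0 : 0 < s) (hs1 : s < 1) (hh : N.IsExit s h) (ho : 0 < h o) :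
    ∃ v, N.IsGreen s o v ∧ (∀ x, 0 < v x → 0 < h x) ∧ 0 < v o := by
  obtain ⟨u, hu⟩ := N.exists_resolvent hs0.le hs1 (fun x => if x = o then 1 else 0)
  have hu : N.IsGreen s o u := hu
  have h0 := hh.nonneg hs0.le hs1
  have u0 := hu.nonneg hs0.le hs1
  -- Positivity of `h` spreads along edges, so no edge leaves the set where `h > 0`, and cutting `u`
  -- off outside this set keeps the Green equation.
  have hadj : ∀ x y, N.w x y ≠ 0 → 0 < h x → 0 < h y := by
    intro x y hxy hx
    have hw : 0 < N.w y x := by rw [N.symm]; exact lt_of_le_of_ne (N.w_nonneg x y) hxy.symm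
    have h1 : N.w y x * h x ≤ ∑ z, N.w y z * h z :=
      Finset.single_le_sum (f := fun z => N.w y z * h z)
        (fun z _ => mul_nonneg (N.w_nonneg y z) (h0 z)) (Finset.mem_univ x)
    have h2 : 0 < N.W y * h y := by
      rw [hh y]
      exact mul_pos hs0 (by linarith [mul_pos hw hx, N.c_nonneg y])
    exact pos_of_mul_pos_right h2 (N.W_pos y).le
  refine ⟨fun x => if 0 < h x then u x else 0, fun x => ?_, fun x hx => ?_, ?_⟩
  · by_cases hx : 0 < h x
    · simp only [if_pos hx]
      rw [hu x]
      congr 2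
      refine Finset.sum_congr rfl fun y _ => ?_
      by_cases hw : N.w x y = 0
      · simp [hw]
      · rw [if_pos (hadj x y hw hx)]
    · have hxo : x ≠ o := by rintro rfl; exact hx ho
      have : ∑ y, N.w x y * (if 0 < h y then u y else 0) = 0 := by
        refine Finset.sum_eq_zero fun y _ => ?_
        by_cases hw : N.w x y = 0
        · simp [hw]
        · rw [if_neg fun hy => hx (hadj y x (by rwa [N.symm]) hy), mul_zero]
      simp only [if_neg hx, if_neg hxo, this, mul_zero, add_zero]
  · by_contra hneg
    simp [hneg] at hx
  · have hpos : 0 < N.W o * u o := by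
      rw [hu o, if_pos rfl]
      have : 0 ≤ ∑ y, N.w o y * u y :=
        Finset.sum_nonneg fun y _ => mul_nonneg (N.w_nonneg o y) (u0 y)
      linarith [mul_nonneg hs0.le this]
    simp only [if_pos ho]
    exact pos_of_mul_pos_right hpos (N.W_pos o).le

/-! ### Entropy production of the flow, from above and from below -/

/-- Green's identity for `log (v / h)` leaves a term at `o`, controlled by the bound on `v o`, and
an average over the exit measure `s * v * c`. The latter has mass `h o`, and Gibbs' inequality
against `c / S` makes its entropy at most that of spreading over all exits; `h ≤ 1` allows `log (v /
h)` to be replaced by `log v`. -/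
theorem flow_log_le (hs0 : 0 < s) (hs1 : s < 1) (hh : N.IsExit s h) (hv : N.IsGreen s o v)
    (ho : 0 < h o) (hvh : ∀ x, 0 < v x → 0 < h x) (hvo : 0 < v o) :
    ∑ x, ∑ y, s * N.w x y * v x * h y * (Real.log (v x / h x) - Real.log (v y / h y))
      ≤ h o * (Real.log ((∑ x, N.c x) / (N.W o * (1 - s))) - 2 * Real.log (h o)) := by
  have v0 := hv.nonneg hs0.le hs1
  have hsum := hh.eq_sum_green hv
  have hSpos := hh.sum_exit_pos hv ho
  set S := ∑ x, N.c x with hS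
  have hpos : 0 < N.W o * (1 - s) := mul_pos (N.W_pos o) (by linarith)
  rw [flow_identity hh hv (fun x => Real.log (v x / h x))]
  -- the entropy of the exit distribution
  have hterm : ∀ x, v x * N.c x * (Real.log (h o / S) + (1 - h o / (s * S * v x)))
      ≤ Real.log (v x / h x) * (v x * N.c x) := by
    intro x
    rcases (v0 x).eq_or_lt with hx | hx
    · simp [← hx]
    · have hhx := hvh x hx
      have hlog : Real.log (h o / S) + (1 - h o / (s * S * v x)) ≤ Real.log (v x / h x) := by
        -- The spare factor `s` in the denominator makes the correction sum to at least zero: `s * ∑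
        -- v * c = h o` balances `s * ∑ c * (h o / (s * S)) = h o`.
        have h1 : Real.log (h o / (S * v x)) ≤ h o / (s * S * v x) - 1 := by
          have hq : 0 < h o / (s * S * v x) := by positivity
          have := Real.log_le_sub_one_of_pos hq
          refine le_trans (Real.log_le_log (by positivity) ?_) this
          gcongr
          nlinarith
        rw [Real.log_div ho.ne' (by positivity), Real.log_mul hSpos.ne' hx.ne'] at h1
        rw [Real.log_div ho.ne' hSpos.ne', Real.log_div hx.ne' hhx.ne']
        have h2 := Real.log_nonpos hhx.le (hh.le_one hs0.le hs1 x)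
        linarith
      rw [mul_comm]
      exact mul_le_mul_of_nonneg_right hlog (mul_nonneg hx.le (N.c_nonneg x))
  have hexit : h o * Real.log (h o / S) ≤ s * ∑ x, Real.log (v x / h x) * (v x * N.c x) := by
    have h1 := Finset.sum_le_sum fun x (_ : x ∈ Finset.univ) => hterm x
    have h2 : ∑ x, v x * N.c x * (Real.log (h o / S) + (1 - h o / (s * S * v x)))
        = (∑ x, v x * N.c x) * Real.log (h o / S) + (∑ x, v x * N.c x)
          - ∑ x, v x * N.c x * (h o / (s * S * v x)) := by
      rw [Finset.sum_mul, ← Finset.sum_add_distrib, ← Finset.sum_sub_distrib]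
      exact Finset.sum_congr rfl fun x _ => by ring
    have h3 : ∑ x, v x * N.c x * (h o / (s * S * v x)) ≤ h o / s := by
      have : h o / s = ∑ x, N.c x * (h o / (s * S)) := by
        rw [← Finset.sum_mul, ← hS]; field_simp
      rw [this]
      refine Finset.sum_le_sum fun x _ => ?_
      rcases (v0 x).eq_or_lt with hx | hx
      · rw [← hx]
        simp only [zero_mul]
        exact mul_nonneg (N.c_nonneg x) (by positivity)
      · apply le_of_eq
        field_simp
    have h4 : s * (h o / s) = h o := by field_simp
    have h5 := mul_le_mul_of_nonneg_left (h2 ▸ h1) hs0.le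
    have h6 := mul_le_mul_of_nonneg_left h3 hs0.le
    rw [h4] at h6
    have h7 : s * ((∑ x, v x * N.c x) * Real.log (h o / S) + (∑ x, v x * N.c x)
          - ∑ x, v x * N.c x * (h o / (s * S * v x)))
        = h o * Real.log (h o / S) + h o - s * ∑ x, v x * N.c x * (h o / (s * S * v x)) := by
      rw [hsum]; ring
    rw [h7] at h5
    linarith
  have hvle : Real.log (v o) ≤ Real.log (1 / (N.W o * (1 - s))) :=
    Real.log_le_log hvo (hv.le hs0.le hs1 o)
  rw [Real.log_div ho.ne' hSpos.ne'] at hexit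
  rw [Real.log_div one_ne_zero hpos.ne', Real.log_one, zero_sub] at hvle
  rw [Real.log_div hvo.ne' ho.ne', Real.log_div hSpos.ne' hpos.ne']
  have := mul_le_mul_of_nonneg_right hvle ho.le
  linarith

/-- `entropy_pair_bound` at `t = log (f / b)`, multiplied by `b`, is the case `d = 1`; exchanging
`f` and `b` gives `d = -1`. For edges inside a level, `d = 0`, the two sides have opposite signs. -/
theorem pair_bound {f b : ℝ} (hf : 0 < f) (hb : 0 < b) {γ : ℝ} {d : ℤ}
    (hd : |d| ≤ 1) :
    (γ + (Real.exp γ - Real.exp (-γ)) / 2) * ((f - b) * d)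
      - (Real.exp γ + Real.exp (-γ) - 2) / 2 * (f + b) ≤ (f - b) * Real.log (f / b) := by
  have main : ∀ f b : ℝ, 0 < f → 0 < b →
      (γ + (Real.exp γ - Real.exp (-γ)) / 2) * (f - b)
      - (Real.exp γ + Real.exp (-γ) - 2) / 2 * (f + b) ≤ (f - b) * Real.log (f / b) := by
    intro f b hf hb
    have h := mul_le_mul_of_nonneg_left (entropy_pair_bound γ (Real.log (f / b))) hb.le
    rw [Real.exp_log (div_pos hf hb)] at h
    have e : b * (f / b) = f := by field_simp
    have e1 : b * (γ * (f / b - 1) + (1 - Real.exp (-γ)) * (f / b) - (Real.exp γ - 1))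
        = γ * (f - b) + (1 - Real.exp (-γ)) * f - (Real.exp γ - 1) * b := by
      linear_combination (γ + 1 - Real.exp (-γ)) * e
    have e2 : b * ((f / b - 1) * Real.log (f / b)) = (f - b) * Real.log (f / b) := by
      linear_combination (Real.log (f / b)) * e
    rw [e1, e2] at h
    linarith
  obtain ⟨h1, h2⟩ := abs_le.mp hd
  interval_cases d
  · have := main b f hb hf
    rw [Real.log_div hb.ne' hf.ne'] at this
    rw [Real.log_div hf.ne' hb.ne']
    push_cast
    linarith
  · have hc : 0 ≤ Real.exp γ + Real.exp (-γ) - 2 := by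
      linarith [Real.add_one_le_exp γ, Real.add_one_le_exp (-γ)]
    have h3 : 0 ≤ (f - b) * Real.log (f / b) := by
      rcases le_total b f with h | h
      · exact mul_nonneg (by linarith) (Real.log_nonneg ((one_le_div hb).mpr h))
      · exact mul_nonneg_of_nonpos_of_nonpos (by linarith)
          (Real.log_nonpos (by positivity) ((div_le_one hb).mpr h))
    have h4 : 0 ≤ (Real.exp γ + Real.exp (-γ) - 2) / 2 * (f + b) := by positivity
    push_cast
    linarith
  · simpa using main f b hf hb

theorem flow_log_ge (hs0 : 0 < s) (hs1 : s < 1) (hv : N.IsGreen s o v)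
    (hvh : ∀ x, 0 < v x → 0 < h x) (ℓ : ι → ℤ) (hℓ : ∀ x y, N.w x y ≠ 0 → |ℓ y - ℓ x| ≤ 1)
    (γ : ℝ) :
    (γ + (Real.exp γ - Real.exp (-γ)) / 2)
        * ∑ x, ∑ y, s * N.w x y * v x * h y * ((ℓ y : ℝ) - ℓ x)
      - (Real.exp γ + Real.exp (-γ) - 2) / 2 * ∑ x, ∑ y, s * N.w x y * v x * h y
      ≤ ∑ x, ∑ y, s * N.w x y * v x * h y * (Real.log (v x / h x) - Real.log (v y / h y)) := by
  have v0 := hv.nonneg hs0.le hs1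
  have hvadj : ∀ x y, N.w x y ≠ 0 → 0 < v x → 0 < v y := by
    intro x y hxy hx
    have hw : 0 < N.w y x := by rw [N.symm]; exact lt_of_le_of_ne (N.w_nonneg x y) hxy.symm
    have h1 : N.w y x * v x ≤ ∑ z, N.w y z * v z :=
      Finset.single_le_sum (f := fun z => N.w y z * v z)
        (fun z _ => mul_nonneg (N.w_nonneg y z) (v0 z)) (Finset.mem_univ x)
    have h2 : 0 < N.W y * v y := by
      rw [hv y]
      have := mul_pos hs0 (lt_of_lt_of_le (mul_pos hw hx) h1)
      split_ifs <;> linarith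
    exact pos_of_mul_pos_right h2 (N.W_pos y).le
  set A := γ + (Real.exp γ - Real.exp (-γ)) / 2 with hA
  set B := (Real.exp γ + Real.exp (-γ) - 2) / 2 with hB
  -- The two orientations of an edge are taken together: `pair_bound` controls only the symmetrized
  -- sum.
  have hpair : ∀ x y,
      (A * (s * N.w x y * v x * h y * ((ℓ y : ℝ) - ℓ x)) - B * (s * N.w x y * v x * h y))
        + (A * (s * N.w y x * v y * h x * ((ℓ x : ℝ) - ℓ y)) - B * (s * N.w y x * v y * h x))
      ≤ s * N.w x y * v x * h y * (Real.log (v x / h x) - Real.log (v y / h y))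
        + s * N.w y x * v y * h x * (Real.log (v y / h y) - Real.log (v x / h x)) := by
    intro x y
    by_cases hw : N.w x y = 0
    · have hw' : N.w y x = 0 := by rw [N.symm, hw]
      simp [hw, hw']
    · have hwp : 0 < N.w x y := lt_of_le_of_ne (N.w_nonneg x y) (Ne.symm hw)
      rcases (v0 x).eq_or_lt with hx | hx
      · have hy : v y = 0 := by
          by_contra hy
          exact absurd (hvadj y x (by rwa [N.symm]) (lt_of_le_of_ne (v0 y) (Ne.symm hy))) (by simp [← hx])
        simp [← hx, hy]
      · have hy := hvadj x y hw hx
        have hhx := hvh x hx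
        have hhy := hvh y hy
        have := pair_bound (f := s * N.w x y * v x * h y) (b := s * N.w x y * v y * h x)
          (by positivity) (by positivity) (γ := γ) (hℓ x y hw)
        have e : Real.log (s * N.w x y * v x * h y / (s * N.w x y * v y * h x))
            = Real.log (v x / h x) - Real.log (v y / h y) := by
          rw [← Real.log_div (by positivity) (by positivity)]
          congr 1
          field_simp
        rw [e, ← hA, ← hB] at this
        rw [N.symm y x]
        push_cast at this
        linarith
  have hswap : ∀ F : ι → ι → ℝ, ∑ x, ∑ y, (F x y + F y x) = 2 * ∑ x, ∑ y, F x y := by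
    intro F
    simp only [Finset.sum_add_distrib]
    rw [Finset.sum_comm (f := fun x y => F y x)]
    ring
  have h1 := Finset.sum_le_sum fun x (_ : x ∈ Finset.univ) =>
    Finset.sum_le_sum fun y (_ : y ∈ Finset.univ) => hpair x y
  rw [hswap (fun x y => A * (s * N.w x y * v x * h y * ((ℓ y : ℝ) - ℓ x))
      - B * (s * N.w x y * v x * h y)),
    hswap (fun x y => s * N.w x y * v x * h y * (Real.log (v x / h x) - Real.log (v y / h y)))]
    at h1
  simp only [Finset.sum_sub_distrib, ← Finset.mul_sum] at h1
  linarith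

/-- Upper bound for the discounted exit function when all exits are at level `m`. -/
theorem IsExit.log_bound {θ : ℝ} (hθ : 0 < θ) (hh : N.IsExit (Real.exp (-θ)) h) (ho : 0 < h o)
    (ℓ : ι → ℤ) (hℓ : ∀ x y, N.w x y ≠ 0 → |ℓ y - ℓ x| ≤ 1) (hℓo : ℓ o = 0) (m : ℤ)
    (hm : ∀ x, N.c x ≠ 0 → ℓ x = m) (γ : ℝ)
    (hc : ∑ x, N.c x ≤ Real.exp (γ * m)) :
    (Real.exp γ - Real.exp (-γ)) / 2 * m
      ≤ Real.log (1 / (N.W o * (1 - Real.exp (-θ))))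
        + (2 + (Real.exp γ + Real.exp (-γ) - 2) / (2 * θ)) * (-Real.log (h o)) := by
  have hs0 := Real.exp_pos (-θ)
  have hs1 : Real.exp (-θ) < 1 := by simpa using hθ
  obtain ⟨v, hv, hvh, hvo⟩ := exists_green hs0 hs1 hh ho
  have h1 := flow_log_le hs0 hs1 hh hv ho hvh hvo
  have h2 := flow_log_ge hs0 hs1 hv hvh ℓ hℓ γ
  -- Net displacement: every trajectory that counts climbs from level `0` to level `m` before its
  -- exit step.
  have h3 : ∑ x, ∑ y, Real.exp (-θ) * N.w x y * v x * h y * ((ℓ y : ℝ) - ℓ x) = m * h o := by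
    have := flow_identity hh hv (fun x => -(ℓ x : ℝ))
    simp only [neg_sub_neg, hℓo] at this
    rw [this]
    have e : ∑ x, -(ℓ x : ℝ) * (v x * N.c x) = -(m : ℝ) * ∑ x, v x * N.c x := by
      rw [Finset.mul_sum]
      refine Finset.sum_congr rfl fun x _ => ?_
      by_cases hc : N.c x = 0
      · simp [hc]
      · rw [hm x hc]
    rw [e]
    have := hh.eq_sum_green hv
    push_cast
    linear_combination (-(m : ℝ)) * this
  have h4 : ∑ x, ∑ y, Real.exp (-θ) * N.w x y * v x * h y ≤ h o * (-Real.log (h o)) / θ := by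
    rw [flow_total v hh, le_div_iff₀ hθ]
    have := hh.expected_time_le hθ hv
    rw [Real.negMulLog] at this
    have h5 : ∑ x, (N.W x * v x * h x - Real.exp (-θ) * (v x * N.c x))
        ≤ ∑ x, N.W x * v x * h x := Finset.sum_le_sum fun x _ => by
      linarith [mul_nonneg hs0.le (mul_nonneg (hv.nonneg hs0.le hs1 x) (N.c_nonneg x))]
    nlinarith
  have hB : 0 ≤ (Real.exp γ + Real.exp (-γ) - 2) / 2 := by
    linarith [Real.add_one_le_exp γ, Real.add_one_le_exp (-γ)]
  have h5 := mul_le_mul_of_nonneg_left h4 hB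
  rw [h3] at h2
  refine le_of_mul_le_mul_left ?_ ho
  have e : (Real.exp γ + Real.exp (-γ) - 2) / 2 * (h o * (-Real.log (h o)) / θ)
      = h o * ((Real.exp γ + Real.exp (-γ) - 2) / (2 * θ) * (-Real.log (h o))) := by
    field_simp
  rw [e] at h5
  have hS := hh.sum_exit_pos hv ho
  have hpos : N.W o * (1 - Real.exp (-θ)) ≠ 0 := (mul_pos (N.W_pos o) (by linarith)).ne'
  -- The exit entropy `log S ≤ γ * m` uses up the part `γ` of the coefficient `γ + sinh γ`, and
  -- `sinh γ` is left.
  have h6 := Real.log_le_log hS hc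
  rw [Real.log_exp] at h6
  rw [Real.log_div hS.ne' hpos] at h1
  rw [Real.log_div one_ne_zero hpos, Real.log_one]
  have h7 := mul_le_mul_of_nonneg_left h6 ho.le
  linarith

end KilledNetwork

/-! ### Distances and countability of balls -/

namespace WeightedGraph

variable {V : Type*} (G : WeightedGraph V)

theorem distance_le_add_one (o : V) {x y : V} (hxy : G.w x y ≠ 0) :
    G.distance o y ≤ G.distance o x + 1 := by
  by_cases h : x = y
  · subst h
    exact le_self_add
  · have hadj : G.toSimpleGraph.Adj x y := ⟨h, hxy⟩
    calc G.distance o y ≤ G.distance o x + G.toSimpleGraph.edist x y :=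
          SimpleGraph.edist_triangle
      _ = G.distance o x + 1 := by rw [SimpleGraph.edist_eq_one_iff_adj.mpr hadj]

theorem exists_neighbor_of_distance_le {o y : V} {n : ℕ} (hy : G.distance o y ≤ n) (hne : y ≠ o) :
    ∃ x, G.w x y ≠ 0 ∧ G.distance o x + 1 ≤ n := by
  obtain ⟨p, hp⟩ := SimpleGraph.exists_walk_of_edist_ne_top
    (ne_top_of_le_ne_top (ENat.natCast_ne_top n) hy)
  have hp' : p.reverse.length = p.length := p.length_reverse
  generalize p.reverse = q at hp'
  cases q with
  | nil => exact absurd rfl hne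
  | @cons _ x _ hadj q =>
    refine ⟨x, by rw [G.symm]; exact hadj.2, ?_⟩
    have h1 : G.distance o x ≤ q.length := by
      rw [distance, SimpleGraph.edist_comm]
      exact SimpleGraph.edist_le q
    have h2 : ((q.length + 1 : ℕ) : ℕ∞) ≤ n := by
      rw [SimpleGraph.Walk.length_cons] at hp'
      rw [hp', hp]
      exact hy
    calc G.distance o x + 1 ≤ q.length + 1 := by gcongr
      _ ≤ n := by exact_mod_cast h2

theorem countable_support (x : V) : {y | G.w x y ≠ 0}.Countable := by
  have := Summable.countable_support_ennreal (G.finite_weight x)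
  refine this.mono fun y hy => ?_
  simpa using hy

/-- `V` may be uncountable, and measurability is only assumed for the events `X k = x`. Summable
weights leave each vertex countably many neighbours, so the events about balls are countable unions.
-/
theorem countable_ball (o : V) (n : ℕ) : {x | G.distance o x ≤ n}.Countable := by
  induction n with
  | zero =>
    refine (Set.countable_singleton o).mono fun x hx => ?_
    have : G.distance o x = 0 := by simpa using hx
    exact (SimpleGraph.edist_eq_zero_iff.mp this).symm
  | succ n ih =>
    refine ((Set.countable_singleton o).union (ih.biUnion fun x _ => G.countable_support x)).mono
      fun y hy => ?_
    by_cases hne : y = o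
    · exact Or.inl hne
    · obtain ⟨x, hxy, hx⟩ := G.exists_neighbor_of_distance_le hy hne
      refine Or.inr (Set.mem_biUnion (x := x) ?_ hxy)
      push_cast at hx
      exact (ENat.add_le_add_iff_right ENat.one_ne_top).mp hx

theorem vertexWeight_pos_of_ne_zero {x y : V} (h : G.w x y ≠ 0) : 0 < G.vertexWeight x := by
  refine lt_of_lt_of_le ?_ (ENNReal.le_tsum y)
  simpa [pos_iff_ne_zero] using h

theorem vertexWeight_pos {o : V} (ho : 0 < G.vertexWeight o) {x : V} {n : ℕ}
    (hx : G.distance o x ≤ n) : 0 < G.vertexWeight x := by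
  by_cases hne : x = o
  · rwa [hne]
  · obtain ⟨y, hy, -⟩ := G.exists_neighbor_of_distance_le hx hne
    exact G.vertexWeight_pos_of_ne_zero (by rwa [G.symm])

theorem tsum_transitionProb {x : V} (hx : 0 < G.vertexWeight x) :
    ∑' y : {y | G.w x y ≠ 0}, G.transitionProb x y = 1 := by
  rw [tsum_subtype {y | G.w x y ≠ 0} (G.transitionProb x)]
  have : {y | G.w x y ≠ 0}.indicator (G.transitionProb x) = G.transitionProb x := by
    refine Set.indicator_eq_self.mpr fun y hy => ?_
    rw [Function.mem_support, transitionProb] at hy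
    intro h0
    simp [h0] at hy
  rw [this]
  simp only [transitionProb, div_eq_mul_inv]
  rw [ENNReal.tsum_mul_right]
  exact ENNReal.mul_inv_cancel hx.ne' (G.finite_weight x)

/-! ### Trajectories of the walk confined to given sets -/

namespace IsRandomWalk

variable {G} {Ω : Type*} {X : ℕ → Ω → V}

theorem prefix_update (x : ℕ → V) (i : ℕ) (y : V) :
    {ω | ∀ j ≤ i + 1, X j ω = Function.update x (i + 1) y j}
      = {ω | (∀ j ≤ i, X j ω = x j) ∧ X (i + 1) ω = y} := by
  ext ω
  simp only [Set.mem_ofPred_eq]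
  constructor
  · intro h
    refine ⟨fun j hj => ?_, by simpa using h (i + 1) le_rfl⟩
    rw [h j (by omega), Function.update_of_ne (by omega)]
  · rintro ⟨h1, h2⟩ j hj
    rcases hj.lt_or_eq with hj | rfl
    · rw [h1 j (by omega), Function.update_of_ne (by omega)]
    · simpa using h2

/-- The trajectories with the given prefix which stay in the sets `C j` for `m` more steps. -/
def confined (X : ℕ → Ω → V) (C : ℕ → Set V) (x : ℕ → V) (i m : ℕ) : Set Ω :=
  {ω | (∀ j ≤ i, X j ω = x j) ∧ ∀ j, i < j → j ≤ i + m → X j ω ∈ C j}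

theorem confined_update {C : ℕ → Set V} {x : ℕ → V} {i m : ℕ} {y : V} {ω : Ω} :
    ω ∈ confined X C (Function.update x (i + 1) y) (i + 1) m ∧ y ∈ C (i + 1) ↔
      ω ∈ confined X C x i (m + 1) ∧ X (i + 1) ω = y := by
  have h := Set.ext_iff.mp (prefix_update (X := X) x i y) ω
  simp only [Set.mem_ofPred_eq] at h
  simp only [confined, Set.mem_ofPred_eq, h]
  constructor
  · rintro ⟨⟨⟨h1, h2⟩, h3⟩, hy⟩
    refine ⟨⟨h1, fun j hj hj' => ?_⟩, h2⟩
    rcases eq_or_lt_of_le (Nat.succ_le_of_lt hj) with rfl | hlt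
    · rwa [h2]
    · exact h3 j hlt (by omega)
  · rintro ⟨⟨h1, h2⟩, h3⟩
    exact ⟨⟨⟨h1, h3⟩, fun j hj hj' => h2 j (by omega) (by omega)⟩,
      h3 ▸ h2 (i + 1) (by omega) (by omega)⟩

variable [MeasurableSpace Ω] {P : Measure Ω} {o : V}

theorem measurableSet_mem (hX : G.IsRandomWalk P o X) (k : ℕ) {C : Set V} (hC : C.Countable) :
    MeasurableSet {ω | X k ω ∈ C} := by
  have : {ω | X k ω ∈ C} = ⋃ x ∈ C, {ω | X k ω = x} := by ext ω; simp
  rw [this]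
  exact MeasurableSet.biUnion hC fun x _ => hX.measurableSet_eq k x

theorem measurableSet_confined (hX : G.IsRandomWalk P o X) {C : ℕ → Set V}
    (hC : ∀ j, (C j).Countable) (x : ℕ → V) (i m : ℕ) : MeasurableSet (confined X C x i m) := by
  have : confined X C x i m = (⋂ j, ⋂ _ : j ≤ i, {ω | X j ω = x j})
      ∩ ⋂ j, ⋂ _ : i < j, ⋂ _ : j ≤ i + m, {ω | X j ω ∈ C j} := by
    ext ω
    simp [confined]
  rw [this]
  exact (MeasurableSet.iInter fun j => MeasurableSet.iInter fun _ =>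
    hX.measurableSet_eq j _).inter (MeasurableSet.iInter fun j => MeasurableSet.iInter fun _ =>
      MeasurableSet.iInter fun _ => hX.measurableSet_mem j (hC j))

/-- The Markov property is given path by path. Since the transition probabilities to the countably
many neighbours sum to `1`, extending a prefix along edges loses no mass, and along edges the
distance grows by at most one per step. -/
theorem le_confined (hX : G.IsRandomWalk P o X) (ho : 0 < G.vertexWeight o) (m : ℕ) :
    ∀ (i : ℕ) (x : ℕ → V), G.distance o (x i) ≤ i →
      P {ω | ∀ j ≤ i, X j ω = x j} ≤ P (confined X (fun j => {z | G.distance o z ≤ j}) x i m) := by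
  set C : ℕ → Set V := fun j => {z | G.distance o z ≤ j} with hCdef
  have hC : ∀ j, (C j).Countable := G.countable_ball o
  induction m with
  | zero =>
    intro i x _
    exact measure_mono fun ω hω => ⟨hω, fun j h1 h2 => by omega⟩
  | succ m ih =>
    intro i x hx
    have hdist : ∀ y ∈ {y | G.w (x i) y ≠ 0}, G.distance o y ≤ (i + 1 : ℕ) := by
      intro y hy
      refine (G.distance_le_add_one o hy).trans ?_
      push_cast
      gcongr
    calc P {ω | ∀ j ≤ i, X j ω = x j}
        = ∑' y : {y | G.w (x i) y ≠ 0}, P {ω | ∀ j ≤ i, X j ω = x j} * G.transitionProb (x i) y := by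
          rw [ENNReal.tsum_mul_left, G.tsum_transitionProb (G.vertexWeight_pos ho hx), mul_one]
      _ ≤ ∑' y : {y | G.w (x i) y ≠ 0},
            P (confined X C (Function.update x (i + 1) y) (i + 1) m) := by
          refine ENNReal.tsum_le_tsum fun y => ?_
          rw [← hX.step i x y, ← prefix_update]
          refine ih (i + 1) _ ?_
          rw [Function.update_self]
          exact hdist y y.2
      _ = P (⋃ y ∈ {y | G.w (x i) y ≠ 0},
            confined X C (Function.update x (i + 1) y) (i + 1) m) := by
          refine (measure_biUnion (G.countable_support (x i)) ?_
            fun y _ => hX.measurableSet_confined hC _ _ _).symm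
          intro y hy z hz hyz
          refine Set.disjoint_left.mpr fun ω h1 h2 => hyz ?_
          rw [← (confined_update.mp ⟨h1, hdist y hy⟩).2, ← (confined_update.mp ⟨h2, hdist z hz⟩).2]
      _ ≤ P (confined X C x i (m + 1)) := by
          refine measure_mono (Set.iUnion₂_subset fun y hy ω hω => ?_)
          exact (confined_update.mp ⟨hω, hdist y hy⟩).1

theorem ae_distance_le [IsProbabilityMeasure P] (hX : G.IsRandomWalk P o X)
    (ho : 0 < G.vertexWeight o) : ∀ᵐ ω ∂P, ∀ k, G.distance o (X k ω) ≤ k := by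
  rw [ae_all_iff]
  intro k
  have hd : G.distance o o = 0 := SimpleGraph.edist_self
  have h0 : P {ω | ∀ j ≤ 0, X j ω = (fun _ : ℕ => o) j} = 1 := by
    simpa using hX.start
  have h1 := hX.le_confined ho k 0 (fun _ => o) (by simp [hd])
  rw [h0] at h1
  have h2 := (prob_compl_eq_zero_iff (hX.measurableSet_confined (G.countable_ball o) (fun _ => o)
    0 k)).mpr (le_antisymm prob_le_one h1)
  refine measure_mono_null ?_ h2
  intro ω hω hmem
  refine hω ?_
  rcases Nat.eq_zero_or_pos k with rfl | hk
  · simp [hmem.1 0 le_rfl, hd]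
  · exact hmem.2 k hk (by omega)

/-- If `H` is multiplied by at most `E` by each step inside `F` and is at least `1` on `Z`, then
it bounds the probability to stay in `F` and to be in `Z` after `m` steps. -/
theorem confined_inter_le (hX : G.IsRandomWalk P o X) (F : Finset V) (Z : Set V)
    (H : V → ℝ≥0∞) (E : ℝ≥0∞) (hZ : ∀ x ∈ F, x ∈ Z → 1 ≤ H x)
    (hH : ∀ x ∈ F, ∑ y ∈ F, G.transitionProb x y * H y ≤ E * H x) (m : ℕ) :
    ∀ (i : ℕ) (x : ℕ → V), x i ∈ F →
      P (confined X (fun _ => F) x i m ∩ {ω | X (i + m) ω ∈ Z})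
        ≤ P {ω | ∀ j ≤ i, X j ω = x j} * (E ^ m * H (x i)) := by
  induction m with
  | zero =>
    intro i x hx
    by_cases hz : x i ∈ Z
    · calc _ ≤ P {ω | ∀ j ≤ i, X j ω = x j} := measure_mono fun ω hω => hω.1.1
        _ = P {ω | ∀ j ≤ i, X j ω = x j} * 1 := (mul_one _).symm
        _ ≤ _ := by
          gcongr
          simpa using hZ _ hx hz
    · have : confined X (fun _ => (F : Set V)) x i 0 ∩ {ω | X (i + 0) ω ∈ Z} = ∅ := by
        refine Set.eq_empty_of_forall_notMem fun ω hω => hz ?_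
        rw [← hω.1.1 i le_rfl]
        exact hω.2
      rw [this, measure_empty]
      exact zero_le
  | succ m ih =>
    intro i x hx
    calc P (confined X (fun _ => F) x i (m + 1) ∩ {ω | X (i + (m + 1)) ω ∈ Z})
        ≤ P (⋃ y ∈ F, confined X (fun _ => F) (Function.update x (i + 1) y) (i + 1) m
            ∩ {ω | X (i + 1 + m) ω ∈ Z}) := by
          refine measure_mono fun ω hω => ?_
          have hy : X (i + 1) ω ∈ F := hω.1.2 (i + 1) (by omega) (by omega)
          refine Set.mem_biUnion (x := X (i + 1) ω) hy ⟨?_, ?_⟩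
          · exact (confined_update.mpr ⟨hω.1, rfl⟩).1
          · have := hω.2
            rwa [show i + (m + 1) = i + 1 + m by omega] at this
      _ ≤ ∑ y ∈ F, P (confined X (fun _ => F) (Function.update x (i + 1) y) (i + 1) m
            ∩ {ω | X (i + 1 + m) ω ∈ Z}) := measure_biUnion_finset_le _ _
      _ ≤ ∑ y ∈ F, P {ω | ∀ j ≤ i, X j ω = x j} * G.transitionProb (x i) y * (E ^ m * H y) := by
          refine Finset.sum_le_sum fun y hy => ?_
          refine (ih (i + 1) (Function.update x (i + 1) y) (by rwa [Function.update_self])).trans ?_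
          rw [prefix_update, hX.step, Function.update_self]
      _ = P {ω | ∀ j ≤ i, X j ω = x j} * E ^ m * ∑ y ∈ F, G.transitionProb (x i) y * H y := by
          rw [Finset.mul_sum]
          exact Finset.sum_congr rfl fun y _ => by ring
      _ ≤ P {ω | ∀ j ≤ i, X j ω = x j} * E ^ m * (E * H (x i)) := by
          gcongr
          exact hH _ hx
      _ = _ := by ring

end IsRandomWalk

end WeightedGraph

/-! ### Comparison of the walk with finite killed networks -/

namespace WeightedGraph

variable {V : Type*} (G : WeightedGraph V)

/-- The graph distance from `o` as a natural number. -/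
noncomputable def level (o x : V) : ℕ := (G.distance o x).toNat

theorem vertexWeight_ne_top (x : V) : G.vertexWeight x ≠ ⊤ := G.finite_weight x

variable {G} {o : V}

theorem coe_level {x : V} (hx : G.distance o x ≠ ⊤) : (G.level o x : ℕ∞) = G.distance o x :=
  ENat.natCast_toNat hx

theorem level_le_add_one {x y : V} (hx : G.distance o x ≠ ⊤) (hxy : G.w x y ≠ 0) :
    G.level o y ≤ G.level o x + 1 := by
  have h := G.distance_le_add_one o hxy
  have hy : G.distance o y ≠ ⊤ :=
    ne_top_of_le_ne_top (by rw [← coe_level hx]; exact ENat.natCast_ne_top (_ + 1)) h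
  rw [← coe_level hx, ← coe_level hy] at h
  exact_mod_cast h

/-- Levels change by at most one along an edge, so these edges join level `m` to level `m + 1` and
lie at distance `m`. The level orients each of them, so no unordered pair is counted twice. -/
theorem sum_boundary_le_levelWeight (F : Finset V) (hF : ∀ x ∈ F, G.distance o x ≠ ⊤) (m : ℕ) :
    ∑ x ∈ F with G.level o x ≤ m, ∑ y ∈ F with ¬ G.level o y ≤ m, (G.w x y : ℝ≥0∞)
      ≤ G.levelWeight o m := by
  classical
  set B := F.filter fun x => G.level o x ≤ m
  set B' := F.filter fun x => ¬ G.level o x ≤ m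
  rw [← Finset.sum_product' B B' (fun x y => (G.w x y : ℝ≥0∞))]
  set T := (B ×ˢ B').filter fun p => G.w p.1 p.2 ≠ 0
  have hT : ∑ p ∈ B ×ˢ B', (G.w p.1 p.2 : ℝ≥0∞) = ∑ p ∈ T, (G.w p.1 p.2 : ℝ≥0∞) := by
    refine (Finset.sum_filter_of_ne fun p _ hp => ?_).symm
    intro h0
    simp [h0] at hp
  have hmem : ∀ p ∈ T, (p.1 ∈ F ∧ G.level o p.1 ≤ m) ∧ (p.2 ∈ F ∧ m < G.level o p.2) ∧
      G.w p.1 p.2 ≠ 0 := by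
    intro p hp
    simp only [T, B, B', Finset.mem_filter, Finset.mem_product, not_le] at hp
    exact ⟨hp.1.1, hp.1.2, hp.2⟩
  have hinj : Set.InjOn (fun p : V × V => s(p.1, p.2)) T := by
    rintro ⟨x, y⟩ hp ⟨x', y'⟩ hq h
    have hp := hmem _ hp
    have hq := hmem _ hq
    rcases Sym2.eq_iff.mp h with ⟨h1, h2⟩ | ⟨h1, h2⟩
    · exact Prod.ext h1 h2
    · dsimp only at h1 h2 hp hq
      subst h1 h2
      omega
  have hsum : ∑ p ∈ T, (G.w p.1 p.2 : ℝ≥0∞)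
      = ∑ e ∈ T.image (fun p : V × V => s(p.1, p.2)), G.edgeWeight e := by
    rw [Finset.sum_image hinj]
    rfl
  have hlevel : G.levelWeight o m
      = ∑' e, {e | G.edgeDistance o e = (m : ℕ∞)}.indicator G.edgeWeight e :=
    tsum_subtype {e | G.edgeDistance o e = (m : ℕ∞)} G.edgeWeight
  rw [hT, hsum, hlevel]
  refine le_trans (Finset.sum_le_sum fun e he => ?_) (ENNReal.sum_le_tsum _)
  obtain ⟨p, hp, rfl⟩ := Finset.mem_image.mp he
  obtain ⟨⟨h1, h2⟩, ⟨h3, h4⟩, h5⟩ := hmem p hp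
  have h6 := level_le_add_one (hF _ h1) h5
  rw [Set.indicator_of_mem]
  change min (G.distance o p.1) (G.distance o p.2) = m
  rw [← coe_level (hF _ h1), ← coe_level (hF _ h3),
    min_eq_left (Nat.cast_le.mpr (by omega : G.level o p.1 ≤ G.level o p.2)),
    (by omega : G.level o p.1 = m)]

/-- The network of the vertices of `F` up to level `m`, killed on leaving `F`, whose exits are the
edges to the vertices of `F` of a higher level. -/
noncomputable def ballNetwork (G : WeightedGraph V) (o : V) (F : Finset V) (m : ℕ)
    (hW : ∀ x ∈ F, 0 < G.vertexWeight x) :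
    KilledNetwork {x // x ∈ F.filter fun x => G.level o x ≤ m} where
  w x y := G.w x y
  c x := ∑ y ∈ F with ¬ G.level o y ≤ m, (G.w x y : ℝ)
  W x := (G.vertexWeight x).toReal
  symm x y := by rw [G.symm]
  w_nonneg x y := NNReal.coe_nonneg _
  c_nonneg x := Finset.sum_nonneg fun y _ => NNReal.coe_nonneg _
  W_pos x := ENNReal.toReal_pos (hW x (Finset.mem_filter.mp x.2).1).ne' (G.vertexWeight_ne_top x)
  sum_le x := by
    rw [Finset.sum_coe_sort (F.filter fun x => G.level o x ≤ m) (fun y => (G.w x y : ℝ)),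
      Finset.sum_filter_add_sum_filter_not]
    rw [← ENNReal.ofReal_le_iff_le_toReal (G.vertexWeight_ne_top x),
      ENNReal.ofReal_sum_of_nonneg fun y _ => NNReal.coe_nonneg _]
    simp only [ENNReal.ofReal_coe_nnreal]
    exact ENNReal.sum_le_tsum F

theorem transitionProb_eq_ofReal {x y : V} (hx : 0 < G.vertexWeight x) :
    G.transitionProb x y = ENNReal.ofReal (G.w x y / (G.vertexWeight x).toReal) := by
  rw [transitionProb, ENNReal.ofReal_div_of_pos (ENNReal.toReal_pos hx.ne' (G.vertexWeight_ne_top x)),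
    ENNReal.ofReal_coe_nnreal, ENNReal.ofReal_toReal (G.vertexWeight_ne_top x)]

theorem sum_transitionProb_le_one (F : Finset V) (x : V) : ∑ y ∈ F, G.transitionProb x y ≤ 1 := by
  refine (ENNReal.sum_le_tsum F).trans ?_
  simp only [transitionProb, div_eq_mul_inv]
  rw [ENNReal.tsum_mul_right]
  exact ENNReal.mul_inv_le_one _

/-- The large deviation rate: the bound on the probability to be beyond level `m` at time `k`. -/
noncomputable def deviationBound (W θ γ : ℝ) (m k : ℕ) : ℝ :=
  Real.exp (θ * k - ((Real.exp γ - Real.exp (-γ)) / 2 * m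
    - Real.log (1 / (W * (1 - Real.exp (-θ)))))
      / (2 + (Real.exp γ + Real.exp (-γ) - 2) / (2 * θ)))

namespace IsRandomWalk

variable {Ω : Type*} [MeasurableSpace Ω] {P : Measure Ω} {X : ℕ → Ω → V}

theorem confined_beyond_le [IsProbabilityMeasure P] (hX : G.IsRandomWalk P o X) (F : Finset V)
    (hoF : o ∈ F) (hW : ∀ x ∈ F, 0 < G.vertexWeight x) (hF : ∀ x ∈ F, G.distance o x ≠ ⊤) (m : ℕ)
    {θ : ℝ} (hθ : 0 < θ) (γ : ℝ)
    (hγ : G.levelWeight o m ≤ ENNReal.ofReal (Real.exp (γ * m))) (k : ℕ) :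
    P (confined X (fun _ => F) (fun _ => o) 0 k ∩ {ω | X (0 + k) ω ∈ {z | m < G.level o z}})
      ≤ ENNReal.ofReal (deviationBound (G.vertexWeight o).toReal θ γ m k) := by
  classical
  set N := G.ballNetwork o F m hW
  have hs0 := Real.exp_pos (-θ)
  have hs1 : Real.exp (-θ) < 1 := by simpa using hθ
  obtain ⟨h, hh⟩ := N.exists_resolvent hs0.le hs1 (fun x => Real.exp (-θ) * N.c x)
  have hh : N.IsExit (Real.exp (-θ)) h := fun x => by rw [hh x]; ring
  have h0 := hh.nonneg hs0.le hs1
  have h1 := hh.le_one hs0.le hs1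
  -- The exit function, extended by `1` beyond level `m`. Inside the ball it is multiplied by
  -- exactly `exp θ` per step. Beyond level `m` the bound `Hr ≤ 1` suffices, so the walk may return
  -- and leave again.
  let Hr : V → ℝ := fun z => if hz : z ∈ F.filter fun x => G.level o x ≤ m then h ⟨z, hz⟩ else 1
  have Hr0 : ∀ z, 0 ≤ Hr z := fun z => by
    simp only [Hr]; split_ifs
    · exact h0 _
    · exact zero_le_one
  have Hr1 : ∀ z, Hr z ≤ 1 := fun z => by
    simp only [Hr]; split_ifs
    · exact h1 _
    · exact le_rfl
  have hd : G.distance o o = 0 := SimpleGraph.edist_self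
  have hlo : G.level o o = 0 := by simp [level, hd]
  have hoB : o ∈ F.filter fun x => G.level o x ≤ m := Finset.mem_filter.mpr ⟨hoF, by omega⟩
  have hE : (1 : ℝ≥0∞) ≤ ENNReal.ofReal (Real.exp θ) := by
    rw [ENNReal.one_le_ofReal]; exact Real.one_le_exp hθ.le
  have key := hX.confined_inter_le F {z | m < G.level o z} (fun z => ENNReal.ofReal (Hr z))
    (ENNReal.ofReal (Real.exp θ))
    (fun x hx hxZ => by
      have : x ∉ F.filter fun x => G.level o x ≤ m := fun hm =>
        absurd (Finset.mem_filter.mp hm).2 (not_le.mpr hxZ)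
      simp only [Hr, dif_neg this, ENNReal.ofReal_one, le_refl])
    (fun x hx => by
      by_cases hxB : x ∈ F.filter fun x => G.level o x ≤ m
      · have hWx := ENNReal.toReal_pos (hW x hx).ne' (G.vertexWeight_ne_top x)
        have e1 : ∀ y ∈ F, G.transitionProb x y * ENNReal.ofReal (Hr y)
            = ENNReal.ofReal (G.w x y * Hr y / (G.vertexWeight x).toReal) := fun y _ => by
          rw [transitionProb_eq_ofReal (hW x hx), ← ENNReal.ofReal_mul (by positivity)]
          congr 1; ring
        rw [Finset.sum_congr rfl e1, ← ENNReal.ofReal_sum_of_nonneg fun y _ =>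
          div_nonneg (mul_nonneg (NNReal.coe_nonneg _) (Hr0 y)) hWx.le,
          ← ENNReal.ofReal_mul (Real.exp_pos θ).le, ← Finset.sum_div]
        refine ENNReal.ofReal_le_ofReal (le_of_eq ?_)
        have e2 : ∑ y ∈ F, (G.w x y : ℝ) * Hr y
            = ∑ y, N.w ⟨x, hxB⟩ y * h y + N.c ⟨x, hxB⟩ := by
          rw [← Finset.sum_filter_add_sum_filter_not F (fun y => G.level o y ≤ m)]
          congr 1
          · rw [← Finset.sum_coe_sort]
            refine Finset.sum_congr rfl fun y _ => ?_
            simp only [Hr, dif_pos y.2]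
            rfl
          · refine Finset.sum_congr rfl fun y hy => ?_
            have : y ∉ F.filter fun x => G.level o x ≤ m := fun hm =>
              (Finset.mem_filter.mp hy).2 (Finset.mem_filter.mp hm).2
            simp only [Hr, dif_neg this, mul_one]
        have e3 := hh ⟨x, hxB⟩
        have e4 : Hr x = h ⟨x, hxB⟩ := by simp only [Hr, dif_pos hxB]
        have e5 : N.W ⟨x, hxB⟩ = (G.vertexWeight x).toReal := rfl
        have e6 : Real.exp θ * Real.exp (-θ) = 1 := by rw [← Real.exp_add]; simp
        rw [e2, e4, div_eq_iff hWx.ne', ← e5]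
        linear_combination Real.exp θ * (-e3) - (∑ y, N.w ⟨x, hxB⟩ y * h y + N.c ⟨x, hxB⟩) * e6
      · have : Hr x = 1 := by simp only [Hr, dif_neg hxB]
        rw [this, ENNReal.ofReal_one, mul_one]
        refine le_trans ?_ hE
        refine le_trans (Finset.sum_le_sum fun y _ => ?_) (sum_transitionProb_le_one (G := G) F x)
        exact mul_le_of_le_one_right' (by simpa using Hr1 y)) k 0 (fun _ => o) hoF
  refine key.trans ?_
  have hHo : Hr o = h ⟨o, hoB⟩ := by simp only [Hr, dif_pos hoB]
  calc P {ω | ∀ j ≤ 0, X j ω = o} * (ENNReal.ofReal (Real.exp θ) ^ k * ENNReal.ofReal (Hr o))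
      ≤ 1 * (ENNReal.ofReal (Real.exp θ) ^ k * ENNReal.ofReal (Hr o)) := by
        gcongr; exact prob_le_one
    _ = ENNReal.ofReal (Real.exp (θ * k) * h ⟨o, hoB⟩) := by
        rw [one_mul, hHo, ← ENNReal.ofReal_pow (Real.exp_pos θ).le,
          ← ENNReal.ofReal_mul (by positivity), ← Real.exp_nat_mul, mul_comm (k : ℝ)]
    _ ≤ _ := by
        refine ENNReal.ofReal_le_ofReal ?_
        rcases (h0 ⟨o, hoB⟩).eq_or_lt with hz | hpos
        · rw [← hz, mul_zero]
          exact (Real.exp_pos _).le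
        have hlev : ∀ x y, N.w x y ≠ 0 → G.level o y ≤ G.level o x + 1 := fun x y hxy =>
          level_le_add_one (hF _ (Finset.mem_filter.mp x.2).1) fun h0 => hxy (by
            change ((G.w x y : ℝ≥0) : ℝ) = 0
            rw [h0]; rfl)
        have hlog := hh.log_bound hθ hpos (fun x => (G.level o x : ℤ))
          (fun x y hxy => by
            have a1 := hlev x y hxy
            have a2 := hlev y x (by rwa [N.symm])
            rw [abs_le]
            constructor <;> omega)
          (by simp [hlo]) m
          (fun x hx => by
            obtain ⟨y, hy, hxy⟩ := Finset.exists_ne_zero_of_sum_ne_zero hx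
            have a1 := (Finset.mem_filter.mp x.2).2
            have a2 := (Finset.mem_filter.mp hy).2
            have a3 := level_le_add_one (o := o) (hF _ (Finset.mem_filter.mp x.2).1)
              (fun h0 => hxy (by rw [h0]; rfl))
            have : G.level o x = m := by omega
            rw [this]) γ
          (by
            have := (sum_boundary_le_levelWeight F hF m).trans hγ
            rw [← Finset.sum_coe_sort] at this
            rw [Int.cast_natCast, ← ENNReal.ofReal_le_ofReal_iff (Real.exp_pos _).le]
            refine le_trans (le_of_eq ?_) this
            rw [ENNReal.ofReal_sum_of_nonneg fun x _ => N.c_nonneg x]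
            refine Finset.sum_congr rfl fun x _ => ?_
            change ENNReal.ofReal (∑ y ∈ F with ¬ G.level o y ≤ m, (G.w x y : ℝ)) = _
            rw [ENNReal.ofReal_sum_of_nonneg fun y _ => NNReal.coe_nonneg _]
            simp only [ENNReal.ofReal_coe_nnreal])
        rw [Int.cast_natCast] at hlog
        have hD : 0 < 2 + (Real.exp γ + Real.exp (-γ) - 2) / (2 * θ) := by
          have : 0 ≤ Real.exp γ + Real.exp (-γ) - 2 := by
            linarith [Real.add_one_le_exp γ, Real.add_one_le_exp (-γ)]
          positivity
        rw [← Real.exp_log hpos, ← Real.exp_add, deviationBound]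
        refine Real.exp_le_exp.mpr ?_
        have : ((Real.exp γ - Real.exp (-γ)) / 2 * m
            - Real.log (1 / ((G.vertexWeight o).toReal * (1 - Real.exp (-θ)))))
            / (2 + (Real.exp γ + Real.exp (-γ) - 2) / (2 * θ)) ≤ -Real.log (h ⟨o, hoB⟩) := by
          rw [div_le_iff₀ hD]
          have e : N.W ⟨o, hoB⟩ = (G.vertexWeight o).toReal := rfl
          rw [e] at hlog
          linarith
        linarith

/-- Up to time `k` the walk almost surely visits finitely many vertices of a countable ball, so the
events of confinement to an exhausting sequence of finite sets increase to the full event; the bound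
does not depend on the finite set. -/
theorem beyond_le [IsProbabilityMeasure P] (hX : G.IsRandomWalk P o X)
    (ho : 0 < G.vertexWeight o) (m : ℕ) {θ : ℝ} (hθ : 0 < θ) (γ : ℝ)
    (hγ : G.levelWeight o m ≤ ENNReal.ofReal (Real.exp (γ * m))) (k : ℕ) :
    P {ω | ((m + 1 : ℕ) : ℕ∞) ≤ G.distance o (X k ω)}
      ≤ ENNReal.ofReal (deviationBound (G.vertexWeight o).toReal θ γ m k) := by
  classical
  have hd : G.distance o o = 0 := SimpleGraph.edist_self
  obtain ⟨f, hf⟩ := (G.countable_ball o k).exists_eq_range ⟨o, by simp [hd]⟩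
  have hfk : ∀ i, G.distance o (f i) ≤ k := fun i => by
    have : f i ∈ {x | G.distance o x ≤ k} := hf ▸ Set.mem_range_self i
    exact this
  let F : ℕ → Finset V := fun n => insert o ((Finset.range n).image f)
  have hFk : ∀ n, ∀ x ∈ F n, G.distance o x ≤ k := by
    intro n x hx
    rcases Finset.mem_insert.mp hx with rfl | hx
    · simp [hd]
    · obtain ⟨i, -, rfl⟩ := Finset.mem_image.mp hx
      exact hfk i
  have hFmono : Monotone F := fun a b hab => Finset.insert_subset_insert _
    (Finset.image_subset_image (Finset.range_mono hab))
  let A : ℕ → Set Ω := fun n => confined X (fun _ => (F n : Set V)) (fun _ => o) 0 k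
    ∩ {ω | X (0 + k) ω ∈ {z | m < G.level o z}}
  have hA : Monotone A := fun a b hab ω hω =>
    ⟨⟨hω.1.1, fun j h1 h2 => hFmono hab (hω.1.2 j h1 h2)⟩, hω.2⟩
  have hcover : P {ω | ((m + 1 : ℕ) : ℕ∞) ≤ G.distance o (X k ω)} ≤ P (⋃ n, A n) := by
    refine measure_mono_ae ?_
    filter_upwards [hX.ae_distance_le ho] with ω hω hm
    have hball : ∀ j, ∃ i, j ≤ k → f i = X j ω := fun j => by
      by_cases hj : j ≤ k
      · have : X j ω ∈ Set.range f := hf ▸ (hω j).trans (by exact_mod_cast hj)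
        exact ⟨this.choose, fun _ => this.choose_spec⟩
      · exact ⟨0, fun h => absurd h hj⟩
    choose i hi using hball
    let n := (Finset.range (k + 1)).sup i + 1
    refine Set.mem_iUnion.mpr ⟨n, ⟨fun j hj => ?_, fun j _ hj => ?_⟩, ?_⟩
    · have h0 : G.distance o (X 0 ω) = 0 := by simpa using hω 0
      rw [Nat.le_zero.mp hj]
      exact (SimpleGraph.edist_eq_zero_iff.mp h0).symm
    · have hj' : j ≤ k := by omega
      refine Finset.mem_coe.mpr (Finset.mem_insert_of_mem (Finset.mem_image.mpr ⟨i j, ?_, hi j hj'⟩))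
      refine Finset.mem_range.mpr (Nat.lt_succ_of_le ?_)
      exact Finset.le_sup (f := i) (Finset.mem_range.mpr (Nat.lt_succ_of_le hj'))
    · have htop : G.distance o (X k ω) ≠ ⊤ := ne_top_of_le_ne_top (ENat.natCast_ne_top k) (hω k)
      change m < G.level o (X (0 + k) ω)
      rw [zero_add]
      have hm' : ((m + 1 : ℕ) : ℕ∞) ≤ G.distance o (X k ω) := hm
      rw [← coe_level htop] at hm'
      exact_mod_cast hm'
  refine hcover.trans ?_
  rw [hA.measure_iUnion]
  refine iSup_le fun n => ?_
  exact hX.confined_beyond_le (F n) (Finset.mem_insert_self _ _)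
    (fun x hx => G.vertexWeight_pos ho (hFk n x hx))
    (fun x hx => ne_top_of_le_ne_top (ENat.natCast_ne_top k) (hFk n x hx)) m hθ γ hγ k

end IsRandomWalk

end WeightedGraph

/-! ### From the growth rate to the speed -/

namespace WeightedGraph

variable {V : Type*} {G : WeightedGraph V} {o : V}

theorem eventually_levelWeight_le {q : ℝ} (hq : 0 < q)
    (hlt : G.upperGrowth o < ENNReal.ofReal q) :
    ∀ᶠ n : ℕ in atTop, G.levelWeight o n ≤ ENNReal.ofReal (Real.exp (Real.log q * n)) := by
  filter_upwards [eventually_lt_of_limsup_lt hlt, eventually_ge_atTop 1] with n hn hn1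
  have hn0 : (n : ℝ) ≠ 0 := by positivity
  have h1 := ENNReal.rpow_le_rpow hn.le (Nat.cast_nonneg n : (0 : ℝ) ≤ n)
  rw [← ENNReal.rpow_mul, one_div_mul_cancel hn0, ENNReal.rpow_one, ENNReal.rpow_natCast,
    ← ENNReal.ofReal_pow hq.le] at h1
  rwa [mul_comm, Real.exp_nat_mul, Real.exp_log hq]

namespace IsRandomWalk

variable {Ω : Type*} [MeasurableSpace Ω] {P : Measure Ω} {X : ℕ → Ω → V}

theorem ae_limsup_le_of_rate [IsProbabilityMeasure P] (hX : G.IsRandomWalk P o X)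
    (ho : 0 < G.vertexWeight o) {q a : ℝ} (hq : 1 < q) (ha : 0 < a)
    (hlt : G.upperGrowth o < ENNReal.ofReal q) (haq : q - 1 < a * (q + 1)) :
    ∀ᵐ ω ∂P, limsup (fun k : ℕ => ((G.distance o (X k ω) : ℕ∞) : ℝ≥0∞) / (k : ℝ≥0∞)) atTop
      ≤ ENNReal.ofReal a := by
  have hq0 : 0 < q := by linarith
  set γ := Real.log q with hγ
  have eγ : Real.exp γ = q := Real.exp_log hq0
  have eγ' : Real.exp (-γ) = q⁻¹ := by rw [Real.exp_neg, eγ]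
  -- `σ = sinh γ` and `τ = cosh γ - 1`, with `τ / σ = (q - 1) / (q + 1)`; the hypothesis on `a` says
  -- `τ < σ * a`.
  set σ := (q - q⁻¹) / 2 with hσ
  set τ := (q + q⁻¹ - 2) / 2 with hτ
  have hgap : 0 < σ * a - τ := by
    have : σ * a - τ = (q - 1) / (2 * q) * (a * (q + 1) - (q - 1)) := by
      rw [hσ, hτ]; field_simp; ring
    rw [this]
    exact mul_pos (div_pos (by linarith) (by linarith)) (by linarith)
  have hσ0 : 0 ≤ σ := by
    have : q⁻¹ ≤ 1 := inv_le_one_of_one_le₀ hq.le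
    rw [hσ]; linarith
  have hτ0 : 0 ≤ τ := by
    have : τ = (q - 1) ^ 2 / (2 * q) := by rw [hτ]; field_simp; ring
    rw [this]; positivity
  -- The decay rate `β` is positive iff `D * θ = 2 * θ + τ < σ * a`; this `θ` puts `2 * θ + τ`
  -- midway between `τ` and `σ * a`.
  set θ := (σ * a - τ) / 4 with hθ
  have hθ0 : 0 < θ := by positivity
  set D := 2 + (q + q⁻¹ - 2) / (2 * θ) with hD
  have hDθ : D * θ = 2 * θ + τ := by rw [hD, hτ]; field_simp
  have hD0 : 0 < D := pos_of_mul_pos_left (by rw [hDθ]; positivity) hθ0.le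
  set L := Real.log (1 / ((G.vertexWeight o).toReal * (1 - Real.exp (-θ)))) with hL
  set β := (σ * a) / D - θ with hβ
  have hβ0 : 0 < β := by
    rw [hβ, sub_pos, lt_div_iff₀ hD0, mul_comm, hDθ]
    rw [hθ]; linarith
  let A : ℕ → Set Ω := fun k => {ω | ((⌈a * k⌉₊ : ℕ) : ℕ∞) ≤ G.distance o (X k ω)}
  -- exponential decay of the probabilities
  have hceil : Tendsto (fun k : ℕ => ⌈a * k⌉₊ - 1) atTop atTop := by
    refine (tendsto_sub_atTop_nat 1).comp (tendsto_nat_ceil_atTop.comp ?_)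
    exact tendsto_natCast_atTop_atTop.const_mul_atTop ha
  have hdecay : ∀ᶠ k : ℕ in atTop,
      P (A k) ≤ ENNReal.ofReal (Real.exp ((σ + L) / D) * Real.exp (-β) ^ k) := by
    filter_upwards [hceil.eventually (eventually_levelWeight_le hq0 hlt),
      eventually_ge_atTop 1] with k hk hk1
    have hpos : 0 < ⌈a * k⌉₊ := Nat.ceil_pos.mpr (by positivity)
    -- Reaching level `⌈a * k⌉₊` means being beyond the level one below. Replacing that level by `a
    -- * k - 1` costs only the constant `σ / D` in the exponent.
    have h1 := hX.beyond_le ho (⌈a * k⌉₊ - 1) hθ0 γ hk k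
    rw [Nat.sub_add_cancel hpos] at h1
    refine h1.trans (ENNReal.ofReal_le_ofReal ?_)
    rw [deviationBound, eγ, eγ', ← Real.exp_nat_mul, ← Real.exp_add]
    refine Real.exp_le_exp.mpr ?_
    have h2 : a * k - 1 ≤ ((⌈a * k⌉₊ - 1 : ℕ) : ℝ) := by
      rw [Nat.cast_sub hpos, Nat.cast_one]
      linarith [Nat.le_ceil (a * k)]
    have h3 : (σ * (a * k - 1) - L) / D ≤ (σ * ((⌈a * k⌉₊ - 1 : ℕ) : ℝ) - L) / D := by
      gcongr
    have h4 : θ * k - (σ * (a * k - 1) - L) / D = (σ + L) / D + k * -β := by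
      rw [hβ]; ring
    linarith
  obtain ⟨K, hK⟩ := eventually_atTop.mp hdecay
  have hsum : ∑' k, P (A (k + K)) ≠ ⊤ := by
    have hr : Real.exp (-β) < 1 := by simpa using hβ0
    have hs : Summable fun k : ℕ => Real.exp ((σ + L) / D) * Real.exp (-β) ^ (k + K) :=
      ((summable_nat_add_iff K).mpr
        (summable_geometric_of_lt_one (Real.exp_pos _).le hr)).mul_left _
    refine ne_top_of_le_ne_top hs.tsum_ofReal_ne_top (ENNReal.tsum_le_tsum fun k => ?_)
    exact hK (k + K) (by omega)
  filter_upwards [ae_eventually_notMem hsum] with ω hω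
  refine limsup_le_of_le (by isBoundedDefault) ?_
  obtain ⟨M, hM⟩ := eventually_atTop.mp hω
  filter_upwards [eventually_ge_atTop (M + K), eventually_ge_atTop 1] with k hk hk1
  have hnot := hM (k - K) (by omega)
  rw [Nat.sub_add_cancel (by omega)] at hnot
  have hlt' : G.distance o (X k ω) < (⌈a * k⌉₊ : ℕ) := not_le.mp hnot
  obtain ⟨d, hd⟩ := ENat.ne_top_iff_exists.mp (ne_top_of_lt hlt')
  rw [← hd] at hlt' ⊢
  have hlt'' : d < ⌈a * k⌉₊ := by exact_mod_cast hlt'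
  have hda : (d : ℝ) ≤ a * k := (Nat.lt_ceil.mp hlt'').le
  refine ENNReal.div_le_of_le_mul ?_
  rw [ENat.toENNReal_coe, ← ENNReal.ofReal_natCast d, ← ENNReal.ofReal_natCast k,
    ← ENNReal.ofReal_mul ha.le]
  exact ENNReal.ofReal_le_ofReal hda

theorem ae_limsup_le_of_lt [IsProbabilityMeasure P] (hX : G.IsRandomWalk P o X)
    (ho : 0 < G.vertexWeight o) {g a : ℝ} (hg : 1 ≤ g)
    (hgrowth : G.upperGrowth o ≤ ENNReal.ofReal g) (hga : (g - 1) / (g + 1) < a) :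
    ∀ᵐ ω ∂P, limsup (fun k : ℕ => ((G.distance o (X k ω) : ℕ∞) : ℝ≥0∞) / (k : ℝ≥0∞)) atTop
      ≤ ENNReal.ofReal a := by
  have ha : 0 < a := lt_of_le_of_lt (div_nonneg (by linarith) (by linarith)) hga
  rw [div_lt_iff₀ (by linarith)] at hga
  set ε := (a * (g + 1) - (g - 1)) / 2 with hε
  have hε0 : 0 < ε := by rw [hε]; linarith
  -- The rate must strictly exceed both `1` and the growth. Half of the slack in `g - 1 < a * (g +
  -- 1)` is spent on raising `g`.
  refine hX.ae_limsup_le_of_rate ho (q := g + ε) (by linarith) ha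
    (lt_of_le_of_lt hgrowth ((ENNReal.ofReal_lt_ofReal_iff (by linarith)).mpr (by linarith))) ?_
  have := mul_pos ha hε0
  linarith

end IsRandomWalk

end WeightedGraph

theorem corollary4 {V : Type*} [Infinite V] (G : WeightedGraph V) (o : V)
    (ho : 0 < G.vertexWeight o)
    {Ω : Type*} [MeasurableSpace Ω] (P : Measure Ω) [IsProbabilityMeasure P]
    (X : ℕ → Ω → V) (hX : G.IsRandomWalk P o X)
    (g₀ g : ℝ≥0∞) (hg₀ : g₀ = G.upperGrowth o) (hg : g = max g₀ 1) :
    ∀ᵐ ω ∂P,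
      limsup (fun k : ℕ => ((G.distance o (X k ω) : ℕ∞) : ℝ≥0∞) / (k : ℝ≥0∞)) atTop
        ≤ speedBound g := by
  by_cases htop : g = ⊤
  · rw [speedBound, if_pos htop]
    filter_upwards [hX.ae_distance_le ho] with ω hω
    refine limsup_le_of_le (by isBoundedDefault) (Eventually.of_forall fun k => ?_)
    refine ENNReal.div_le_of_le_mul ?_
    rw [one_mul, ← ENat.toENNReal_coe]
    exact ENat.toENNReal_le.mpr (hω k)
  · have hg1 : 1 ≤ g := hg ▸ le_max_right _ _
    have hr : 1 ≤ g.toReal := by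
      rwa [← ENNReal.ofReal_le_iff_le_toReal htop, ENNReal.ofReal_one]
    have hgrowth : G.upperGrowth o ≤ ENNReal.ofReal g.toReal := by
      rw [ENNReal.ofReal_toReal htop, hg, hg₀]
      exact le_max_left _ _
    have hspeed : speedBound g = ENNReal.ofReal ((g.toReal - 1) / (g.toReal + 1)) := by
      rw [speedBound, if_neg htop, ENNReal.ofReal_div_of_pos (by linarith),
        ENNReal.ofReal_sub _ zero_le_one, ENNReal.ofReal_add (by linarith) zero_le_one,
        ENNReal.ofReal_toReal htop, ENNReal.ofReal_one]
    have hall : ∀ᵐ ω ∂P, ∀ j : ℕ,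
        limsup (fun k : ℕ => ((G.distance o (X k ω) : ℕ∞) : ℝ≥0∞) / (k : ℝ≥0∞)) atTop
          ≤ ENNReal.ofReal ((g.toReal - 1) / (g.toReal + 1) + 1 / ((j : ℝ) + 1)) :=
      ae_all_iff.mpr fun j => hX.ae_limsup_le_of_lt ho hr hgrowth
        (lt_add_of_pos_right _ (by positivity))
    filter_upwards [hall] with ω hω
    rw [hspeed]
    have hlim := (tendsto_one_div_add_atTop_nhds_zero_nat (𝕜 := ℝ)).const_add
      ((g.toReal - 1) / (g.toReal + 1))
    rw [add_zero] at hlim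
    exact ge_of_tendsto' (ENNReal.tendsto_ofReal hlim) hω
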